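/- Let $(Y_t)_{t\in\mathbb Z}$ be independent real random variables on a probability space with $\mathbb E Y_t=0$, $\mathbb V Y_t=1$ and, for every $k\in\mathbb N$, $\sup_{t}\mathbb E|Y_t|^k<\infty$. Write $\mathcal N(0,0):=\delta_0$. (i) Let $(c_s)_{s\in\mathbb Z}\in\ell^1(\mathbb Z)$ be real with $\sum_{s\in\mathbb Z}|s|^k|c_s|<\infty$ for all $k\in\mathbb N$, and set $X_t:=\sum_{s\in\mathbb Z}c_sY_{t-s}$ (the series converges absolutely almost surely). Then the limit $$\sigma^2:=\lim_{n\to\infty}\frac1n\sum_{t,t'=1}^n\ \sum_{s\in\mathbb Z}c_{t-s}c_{t'-s}$$ exists in $[0,\infty)$, where the inner series converge absolutely, and $n^{-1/2}\sum_{t=1}^nX_t\to\mathcal N(0,\sigma^2)$ weakly as $n\to\infty$. (ii) Let $p,q\ge 0$ be integers and $a_1,\dots,a_p,b_1,\dots,b_q\in\mathbb R$. Let $A(z)=1+\sum_{j=1}^pa_jz^j$ and $B(z)=1+\sum_{j=1}^qb_jz^j$, and let $A_0$ be $A$ divided by the greatest common divisor of $A$ and $B$ and normalized so that $A_0(0)=1$.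 Assume that $A_0$ has no complex root of absolute value $1$. Consider the ARMA$(p,q)$ equations $$X_t+\sum_{j=1}^pa_jX_{t-j}=Y_t+\sum_{j=1}^qb_jY_{t-j}\quad\text{almost surely, for every }t\in\mathbb Z.\qquad(*)$$ Then there is exactly one real sequence $(c_s)\in\ell^1(\mathbb Z)$ for which the process $X_t=\sum_{s\in\mathbb Z}c_sY_{t-s}$ solves $(*)$. It satisfies $|c_s|\le Cr^{|s|}$ for some $C\in\mathbb R$, $r\in(0,1)$ and all $s$, and the limit $\sigma^2$ and the weak convergence in (i) hold for it. If $A$ itself has no complex root of absolute value $1$ (for instance, if $A$ has no root in the closed unit disc, the causal case), then every solution $(X_t)$ of $(*)$ with $\sup_t\mathbb E X_t^2<\infty$ (in particular every weakly stationary solution) satisfies $X_t=\sum_sc_sY_{t-s}$ almost surely for every $t$, and hence $n^{-1/2}\sum_{t=1}^nX_t\to\mathcal N(0,\sigma^2)$ weakly with the same $\sigma^2$. -/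

import Mathlib

open MeasureTheory ProbabilityTheory Filter Topology
open scoped NNReal

/-- The moving average `X_t = ∑_{s ∈ ℤ} c_s Y_{t-s}` (pointwise sum of the series). -/
noncomputable def maProcess {Ω : Type*} (c : ℤ → ℝ) (Y : ℤ → Ω → ℝ) (t : ℤ) (ω : Ω) : ℝ :=
  ∑' s : ℤ, c s * Y (t - s) ω

/-- The normalized sum `n^{-1/2} ∑_{t=1}^n X_t`. -/
noncomputable def normalizedSum {Ω : Type*} (X : ℤ → Ω → ℝ) (n : ℕ) (ω : Ω) : ℝ :=
  (1 / Real.sqrt n) * ∑ t ∈ Finset.Icc (1 : ℤ) n, X t ω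

/-- `n^{-1/2} ∑_{t=1}^n X_t` converges weakly to `N(0, v)`, where `N(0, 0) = δ_0`. -/
def SatisfiesCLT {Ω : Type*} [MeasurableSpace Ω] (P : Measure Ω) [IsProbabilityMeasure P]
    (X : ℤ → Ω → ℝ) (v : ℝ≥0) : Prop :=
  TendstoInDistribution (fun n : ℕ => normalizedSum X n) atTop (id : ℝ → ℝ)
    (fun _ => P) (gaussianReal 0 v)

/-- `(1/n) ∑_{t,t'=1}^n ∑_{s ∈ ℤ} c_{t-s} c_{t'-s}`. -/
noncomputable def averagedCovariance (c : ℤ → ℝ) (n : ℕ) : ℝ :=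
  (1 / (n : ℝ)) * ∑ t ∈ Finset.Icc (1 : ℤ) n, ∑ t' ∈ Finset.Icc (1 : ℤ) n,
    ∑' s : ℤ, c (t - s) * c (t' - s)

/-- `X_t + ∑_{j=1}^p a_j X_{t-j} = Y_t + ∑_{j=1}^q b_j Y_{t-j}` almost surely, for all `t ∈ ℤ`. -/
def IsARMA {Ω : Type*} [MeasurableSpace Ω] (P : Measure Ω) (p q : ℕ) (a b : ℕ → ℝ)
    (Y X : ℤ → Ω → ℝ) : Prop :=
  ∀ t : ℤ, ∀ᵐ ω ∂P,
    X t ω + ∑ j ∈ Finset.Icc 1 p, a j * X (t - (j : ℤ)) ω =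
      Y t ω + ∑ j ∈ Finset.Icc 1 q, b j * Y (t - (j : ℤ)) ω

/-- The polynomial `1 + ∑_{j=1}^p a_j z^j`. -/
noncomputable def lagPoly (p : ℕ) (a : ℕ → ℝ) : Polynomial ℝ :=
  1 + ∑ j ∈ Finset.Icc 1 p, Polynomial.C (a j) * Polynomial.X ^ j

/-- The polynomial `A` with the factors it has in common with `B` removed (counted with
multiplicity), normalized to have constant coefficient `1` (when `A(0) ≠ 0`). -/
noncomputable def reducedPoly (A B : Polynomial ℝ) : Polynomial ℝ :=
  Polynomial.C ((A / EuclideanDomain.gcd A B).coeff 0)⁻¹ * (A / EuclideanDomain.gcd A B)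

/-- The polynomial has no complex root of absolute value `1`. -/
def NoUnitRoot (A : Polynomial ℝ) : Prop :=
  ∀ z : ℂ, ‖z‖ = 1 → Polynomial.aeval z A ≠ 0

/-!
The algebraic half of the argument lets a real polynomial `A` act on two-sided sequences as `A(S)`,
where `S` is the backward shift (`lagFilter`). On geometrically decaying sequences `S - ρ` is onto
when `|ρ| ≠ 1`, by a geometric series running forwards or backwards; factoring over `ℂ` makes `A(S)`
onto for every `A` without zeros on the unit circle (`NoUnitRoot.exists_lagFilter`). On sequences
vanishing at infinity every nonzero `A(S)` is injective, even with zeros on the circle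
(`eq_zero_of_lagFilter_eq_zero`). As the `Y_t` are orthonormal, an `ℓ¹` moving average solves the
ARMA equations exactly when its coefficients satisfy `A(S) c = B(S) δ` (`isARMA_maProcess_iff`), so
existence and uniqueness of `c` are these two facts, with the greatest common divisor cancelled for
existence. If `A(S) g = δ` with `g` geometrically decaying, then convolving `A(S) X = B(S) Y` with
`g` recovers any `L¹`-bounded solution: `X = (B(S) g) * Y` (`IsARMA.ae_eq_maProcess`).

For the central limit theorem, put `m = ∑ c_s`. Then `∑_{t ≤ n} X_t - m ∑_{t ≤ n} Y_t` is a series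
in `s` of `c_s` times the difference of two windows shifted by `s`, whose `L¹` norm is at most a
multiple of `|s|`. Since `∑ |s| |c_s| < ∞`, the difference is bounded in `L¹` uniformly in `n` and
vanishes in probability after division by `√n`
(`tendstoInMeasure_normalizedSum_maProcess_sub`). There remains the central limit theorem for
`m Y_t`, which follows from a third order expansion of characteristic functions and Lévy's
continuity theorem. The averaged covariances are Cesàro means of the symmetric partial sums of
`∑_k ∑_s c_{k+s} c_s = m²`, so they converge to the same variance `m²`.
-/

/-! ### Lag polynomials acting on two-sided sequences -/

section LagFilter

variable {R M : Type*} [CommRing R] [AddCommGroup M] [Module R M]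

/-- The backward shift `(S h) t = h (t - 1)` on two-sided sequences. -/
def backShift (R M : Type*) [CommRing R] [AddCommGroup M] [Module R M] :
    Module.End R (ℤ → M) :=
  LinearMap.funLeft R M (fun t : ℤ => t - 1)

/-- The linear filter `A(S)` attached to a polynomial `A`, where `S` is the backward shift:
`(A(S) h) t = ∑ i, A_i h (t - i)`. -/
noncomputable def lagFilter (A : Polynomial R) : Module.End R (ℤ → M) :=
  Polynomial.aeval (backShift R M) A

lemma backShift_apply (h : ℤ → M) (t : ℤ) : backShift R M h t = h (t - 1) := rfl

lemma backShift_pow_apply (i : ℕ) (h : ℤ → M) (t : ℤ) :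
    (backShift R M ^ i) h t = h (t - i) := by
  induction i generalizing t with
  | zero => simp
  | succ n ih =>
    rw [pow_succ', Module.End.mul_apply, backShift_apply, ih]
    congr 1
    push_cast
    ring

lemma lagFilter_mul (A B : Polynomial R) (h : ℤ → M) :
    lagFilter (A * B) h = lagFilter A (lagFilter B h) := by
  simp [lagFilter]

lemma lagFilter_eq_sum_range {A : Polynomial R} {n : ℕ} (hn : A.natDegree < n) (h : ℤ → M)
    (t : ℤ) : lagFilter A h t = ∑ i ∈ Finset.range n, A.coeff i • h (t - i) := by
  rw [lagFilter, Polynomial.aeval_eq_sum_range' hn, LinearMap.sum_apply, Finset.sum_apply]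
  simp [backShift_pow_apply]

lemma lagFilter_X_sub_C_apply (ρ : R) (h : ℤ → M) (t : ℤ) :
    lagFilter (Polynomial.X - Polynomial.C ρ) h t = h (t - 1) - ρ • h t := by
  simp [lagFilter, backShift_apply]

end LagFilter

lemma lagFilter_lagPoly_apply (p : ℕ) (a : ℕ → ℝ) (h : ℤ → ℝ) (t : ℤ) :
    lagFilter (lagPoly p a) h t = h t + ∑ j ∈ Finset.Icc 1 p, a j * h (t - (j : ℤ)) := by
  simp [lagFilter, lagPoly, backShift_pow_apply, LinearMap.sum_apply, Finset.sum_apply]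

lemma re_lagFilter_map (A : Polynomial ℝ) (h : ℤ → ℂ) (t : ℤ) :
    (lagFilter (A.map Complex.ofRealHom) h t).re = lagFilter A (fun s => (h s).re) t := by
  rw [lagFilter_eq_sum_range (Nat.lt_succ_of_le Polynomial.natDegree_map_le),
    lagFilter_eq_sum_range (Nat.lt_succ_self _)]
  simp

lemma lagFilter_map_ofReal (A : Polynomial ℝ) (h : ℤ → ℝ) (t : ℤ) :
    lagFilter (A.map Complex.ofRealHom) (fun s => (h s : ℂ)) t =
      Complex.ofReal (lagFilter A h t) := by
  rw [lagFilter_eq_sum_range (Nat.lt_succ_of_le Polynomial.natDegree_map_le),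
    lagFilter_eq_sum_range (Nat.lt_succ_self _)]
  simp

/-- A polynomial filter commutes with convolution when it is applied to the kernel. -/
lemma hasSum_lagFilter_mul (A : Polynomial ℝ) {c y : ℤ → ℝ}
    (hs : ∀ t, Summable fun s => c s * y (t - s)) (t : ℤ) :
    HasSum (fun s => lagFilter A c s * y (t - s))
      (lagFilter A (fun t => ∑' s, c s * y (t - s)) t) := by
  simp only [lagFilter_eq_sum_range (Nat.lt_succ_self _), Finset.sum_mul, smul_eq_mul]
  refine hasSum_sum fun i _ => ?_
  have h := (Equiv.subRight (i : ℤ)).hasSum_iff.2 ((hs (t - i)).hasSum.mul_left (A.coeff i))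
  have e : ∀ s : ℤ, A.coeff i * c (s - i) * y (t - s) =
      A.coeff i * (c (s - i) * y (t - i - (s - i))) := fun s => by
    rw [mul_assoc, sub_sub_sub_cancel_right]
  simp only [e]
  exact h

/-- A polynomial filter commutes with convolution when it is applied to the signal. -/
lemma hasSum_mul_lagFilter (A : Polynomial ℝ) {c y : ℤ → ℝ}
    (hs : ∀ t, Summable fun s => c s * y (t - s)) (t : ℤ) :
    HasSum (fun s => c s * lagFilter A y (t - s))
      (lagFilter A (fun t => ∑' s, c s * y (t - s)) t) := by
  simp only [lagFilter_eq_sum_range (Nat.lt_succ_self _), Finset.mul_sum, smul_eq_mul]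
  refine hasSum_sum fun i _ => ?_
  have e : ∀ s : ℤ, c s * (A.coeff i * y (t - s - i)) = A.coeff i * (c s * y (t - i - s)) :=
    fun s => by rw [mul_left_comm, sub_right_comm]
  simpa only [e] using (hs (t - i)).hasSum.mul_left (A.coeff i)

/-! ### Inverting filters on geometrically decaying sequences -/

/-- `‖h s‖ ≤ C r ^ |s|` for some constant `C` and some ratio `r ∈ (0, 1)`. -/
def GeomDecay {E : Type*} [Norm E] (h : ℤ → E) : Prop :=
  ∃ C r : ℝ, 0 < r ∧ r < 1 ∧ ∀ s : ℤ, ‖h s‖ ≤ C * r ^ s.natAbs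

section GeomDecay

variable {E : Type*} [NormedField E]

lemma GeomDecay.exists_rate {h : ℤ → E} (hh : GeomDecay h) {q : ℝ} (hq : q < 1) :
    ∃ C r : ℝ, 0 ≤ C ∧ 0 < r ∧ r < 1 ∧ q ≤ r ∧ ∀ s : ℤ, ‖h s‖ ≤ C * r ^ s.natAbs := by
  obtain ⟨C, r, h0, h1, hb⟩ := hh
  have hC : 0 ≤ C := by simpa using (norm_nonneg _).trans (hb 0)
  refine ⟨C, max r q, hC, lt_max_of_lt_left h0, max_lt h1 hq, le_max_right _ _, fun s => ?_⟩
  refine (hb s).trans ?_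
  gcongr
  exact le_max_left _ _

lemma GeomDecay.comp_sub {h : ℤ → E} (hh : GeomDecay h) (i : ℤ) :
    GeomDecay (fun s => h (s - i)) := by
  obtain ⟨C, r, hC, h0, h1, -, hb⟩ := hh.exists_rate one_half_lt_one
  refine ⟨C * (r ^ i.natAbs)⁻¹, r, h0, h1, fun s => (hb _).trans ?_⟩
  rw [mul_assoc]
  gcongr
  rw [← div_eq_inv_mul, le_div_iff₀ (by positivity), ← pow_add]
  exact pow_le_pow_of_le_one h0.le h1.le (by omega)

lemma GeomDecay.const_mul {h : ℤ → E} (hh : GeomDecay h) (a : E) :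
    GeomDecay (fun s => a * h s) := by
  obtain ⟨C, r, h0, h1, hb⟩ := hh
  refine ⟨‖a‖ * C, r, h0, h1, fun s => ?_⟩
  rw [norm_mul, mul_assoc]
  gcongr
  exact hb s

lemma GeomDecay.add {g h : ℤ → E} (hg : GeomDecay g) (hh : GeomDecay h) :
    GeomDecay (fun s => g s + h s) := by
  obtain ⟨C, r, h0, h1, hb⟩ := hg
  obtain ⟨D, r', hD, h0', h1', hr, hb'⟩ := hh.exists_rate h1
  have hC : 0 ≤ C := by simpa using (norm_nonneg _).trans (hb 0)
  refine ⟨C + D, r', h0', h1', fun s => (norm_add_le _ _).trans ?_⟩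
  rw [add_mul]
  refine add_le_add ((hb s).trans ?_) (hb' s)
  gcongr

lemma geomDecay_sum {ι : Type*} (I : Finset ι) {h : ι → ℤ → E} (hh : ∀ i, GeomDecay (h i)) :
    GeomDecay (fun s => ∑ i ∈ I, h i s) := by
  classical
  induction I using Finset.induction_on with
  | empty => exact ⟨0, 1 / 2, by norm_num, by norm_num, by simp⟩
  | insert i I hi ih =>
    simp only [Finset.sum_insert hi]
    exact (hh i).add ih

lemma GeomDecay.lagFilter {h : ℤ → E} (hh : GeomDecay h) (A : Polynomial E) :
    GeomDecay (lagFilter A h) := by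
  have : _root_.lagFilter A h = _ :=
    funext fun t => lagFilter_eq_sum_range (Nat.lt_succ_self _) h t
  rw [this]
  exact geomDecay_sum _ fun i => (hh.comp_sub i).const_mul _

lemma geomDecay_single : GeomDecay (Pi.single 0 1 : ℤ → E) := by
  refine ⟨1, 1 / 2, by norm_num, by norm_num, fun s => ?_⟩
  by_cases hs : s = 0
  · simp [hs]
  · simp only [ne_eq, hs, not_false_eq_true, Pi.single_eq_of_ne, norm_zero]
    positivity

/-- The solution of `u s = h s + μ u (s ± 1)` that decays, namely `∑ k, μ ^ k h (s ± k)`. -/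
lemma GeomDecay.exists_geom_series [CompleteSpace E] {h : ℤ → E} (hh : GeomDecay h) {μ : E}
    (hμ : ‖μ‖ < 1) {ε : ℤ} (hε : ε.natAbs = 1) :
    ∃ u : ℤ → E, GeomDecay u ∧ ∀ s, u s = h s + μ * u (s + ε) := by
  obtain ⟨C, r, hC, h0, h1, hr, hb⟩ := hh.exists_rate hμ
  -- a slightly slower rate absorbs the number of terms of the convolution
  obtain ⟨r', hr', h1'⟩ := exists_between h1
  have h0' : 0 < r' := h0.trans hr'
  have hq : r / r' < 1 := (div_lt_one h0').2 hr'
  have key : ∀ (s : ℤ) (k : ℕ), ‖μ ^ k * h (s + k * ε)‖ ≤ (C * r' ^ s.natAbs) * (r / r') ^ k := by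
    intro s k
    have h2 : s.natAbs ≤ k + (s + k * ε).natAbs := by
      have : (k * ε : ℤ).natAbs = k := by simp [Int.natAbs_mul, hε]
      omega
    calc ‖μ ^ k * h (s + k * ε)‖ = ‖μ‖ ^ k * ‖h (s + k * ε)‖ := by rw [norm_mul, norm_pow]
      _ ≤ r ^ k * (C * r' ^ (s + k * ε).natAbs) := by
        gcongr
        exact (hb _).trans (by gcongr)
      _ = C * (r / r') ^ k * r' ^ (k + (s + k * ε).natAbs) := by
        rw [pow_add, div_pow]
        field_simp
      _ ≤ C * (r / r') ^ k * r' ^ s.natAbs := by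
        gcongr ?_ * ?_
        exact pow_le_pow_of_le_one h0'.le h1'.le h2
      _ = _ := by ring
  have hgeo := summable_geometric_of_lt_one (by positivity) hq
  have hsum : ∀ s, Summable fun k : ℕ => μ ^ k * h (s + k * ε) := fun s =>
    Summable.of_norm_bounded (hgeo.mul_left _) (key s)
  refine ⟨fun s => ∑' k : ℕ, μ ^ k * h (s + k * ε),
    ⟨C * (1 - r / r')⁻¹, r', h0', h1', fun s => ?_⟩, fun s => ?_⟩
  · refine (tsum_of_norm_bounded (hgeo.mul_left _).hasSum (key s)).trans_eq ?_
    rw [tsum_mul_left, tsum_geometric_of_lt_one (by positivity) hq]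
    ring
  · dsimp only
    rw [(hsum s).tsum_eq_zero_add, ← tsum_mul_left]
    simp only [pow_zero, Nat.cast_zero, zero_mul, add_zero, one_mul]
    congr 1
    refine tsum_congr fun k => ?_
    rw [pow_succ', mul_assoc]
    congr 3
    push_cast
    ring

lemma GeomDecay.exists_lagFilter_X_sub_C [CompleteSpace E] {h : ℤ → E} (hh : GeomDecay h) {ρ : E}
    (hρ : ‖ρ‖ ≠ 1) :
    ∃ g : ℤ → E, GeomDecay g ∧ _root_.lagFilter (Polynomial.X - Polynomial.C ρ) g = h := by
  rcases lt_or_gt_of_ne hρ with hlt | hgt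
  · obtain ⟨u, hu, he⟩ := hh.exists_geom_series hlt (ε := 1) rfl
    refine ⟨fun s => u (s - (-1)), hu.comp_sub _, funext fun t => ?_⟩
    rw [lagFilter_X_sub_C_apply]
    have := he t
    simp only [sub_neg_eq_add, sub_add_cancel, smul_eq_mul]
    rw [this]
    ring
  · have h0 : ρ ≠ 0 := by
      rintro rfl
      simp at hgt
      linarith
    obtain ⟨u, hu, he⟩ := hh.exists_geom_series (μ := ρ⁻¹)
      (by rw [norm_inv]; exact inv_lt_one_of_one_lt₀ hgt) (ε := -1) rfl
    refine ⟨fun s => -ρ⁻¹ * u s, hu.const_mul _, funext fun t => ?_⟩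
    rw [lagFilter_X_sub_C_apply]
    have := he t
    rw [← sub_eq_add_neg] at this
    rw [smul_eq_mul, ← mul_assoc, show ρ * -ρ⁻¹ = -1 by field_simp, this]
    ring

end GeomDecay

/-- Filters without zeros on the unit circle are onto on geometrically decaying sequences. -/
lemma GeomDecay.exists_lagFilter_complex {A : Polynomial ℂ} (hA : A ≠ 0)
    (hroot : ∀ z ∈ A.roots, ‖z‖ ≠ 1) {h : ℤ → ℂ} (hh : GeomDecay h) :
    ∃ g : ℤ → ℂ, GeomDecay g ∧ _root_.lagFilter A g = h := by
  have aux : ∀ (m : Multiset ℂ), (∀ z ∈ m, ‖z‖ ≠ 1) → ∀ h : ℤ → ℂ, GeomDecay h →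
      ∃ g : ℤ → ℂ, GeomDecay g ∧
        _root_.lagFilter (m.map fun z => Polynomial.X - Polynomial.C z).prod g = h := by
    intro m
    induction m using Multiset.induction_on with
    | empty => exact fun _ h hh => ⟨h, hh, by simp [_root_.lagFilter]⟩
    | cons z m ih =>
      intro hm h hh
      obtain ⟨g₁, hg₁, he₁⟩ := hh.exists_lagFilter_X_sub_C (hm z (by simp))
      obtain ⟨g, hg, he⟩ := ih (fun w hw => hm w (by simp [hw])) g₁ hg₁
      exact ⟨g, hg, by rw [Multiset.map_cons, Multiset.prod_cons, lagFilter_mul, he, he₁]⟩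
  obtain ⟨g, hg, he⟩ := aux A.roots hroot _ (hh.const_mul A.leadingCoeff⁻¹)
  refine ⟨g, hg, ?_⟩
  rw [(IsAlgClosed.splits A).eq_prod_roots, lagFilter_mul, he]
  ext t
  simp [_root_.lagFilter, Polynomial.leadingCoeff_ne_zero.2 hA]

lemma NoUnitRoot.ne_zero {A : Polynomial ℝ} (hA : NoUnitRoot A) : A ≠ 0 := by
  rintro rfl
  exact hA 1 (by simp) (by simp)

lemma NoUnitRoot.exists_lagFilter {A : Polynomial ℝ} (hA : NoUnitRoot A) {h : ℤ → ℝ}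
    (hh : GeomDecay h) : ∃ g : ℤ → ℝ, GeomDecay g ∧ lagFilter A g = h := by
  have hh' : GeomDecay fun s => (h s : ℂ) := by simpa [GeomDecay] using hh
  obtain ⟨g, ⟨C, r, h0, h1, hb⟩, he⟩ :=
    GeomDecay.exists_lagFilter_complex (A := A.map Complex.ofRealHom)
      ((Polynomial.map_ne_zero_iff Complex.ofRealHom.injective).2 hA.ne_zero)
      (fun z hz h1 => hA z h1 (by
        rw [Polynomial.mem_roots', Polynomial.IsRoot.def, Polynomial.eval_map] at hz
        exact hz.2)) hh'
  refine ⟨fun s => (g s).re, ⟨C, r, h0, h1, fun s => (Complex.abs_re_le_norm _).trans (hb s)⟩,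
    funext fun t => ?_⟩
  rw [← re_lagFilter_map, he, Complex.ofReal_re]

/-- A solution of `h (t - 1) = ρ h t` has monotone `‖h‖`, so it vanishes if `h → 0` at both
ends. -/
lemma eq_zero_of_lagFilter_X_sub_C {ρ : ℂ} {h : ℤ → ℂ} (hh : Tendsto h cofinite (𝓝 0))
    (h0 : lagFilter (Polynomial.X - Polynomial.C ρ) h = 0) : h = 0 := by
  have hrec : ∀ t, h (t - 1) = ρ * h t := fun t => by
    have := congrFun h0 t
    rwa [lagFilter_X_sub_C_apply, Pi.zero_apply, sub_eq_zero, smul_eq_mul] at this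
  have hpow : ∀ (k : ℕ) (t : ℤ), h (t - k) = ρ ^ k * h t := by
    intro k
    induction k with
    | zero => simp
    | succ n ih =>
      intro t
      rw [pow_succ', mul_assoc, ← ih t, ← hrec]
      congr 1
      push_cast
      ring
  ext t
  rcases le_total 1 ‖ρ‖ with h1 | h1
  · have hlim : Tendsto (fun k : ℕ => ‖h (t - k)‖) atTop (𝓝 0) := by
      rw [← Nat.cofinite_eq_atTop]
      refine tendsto_zero_iff_norm_tendsto_zero.1 (hh.comp ?_)
      exact Function.Injective.tendsto_cofinite fun a b hab => by simpa using hab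
    have := ge_of_tendsto' hlim fun k => show ‖h t‖ ≤ _ by
      rw [hpow, norm_mul, norm_pow]
      exact le_mul_of_one_le_left (norm_nonneg _) (one_le_pow₀ h1)
    simpa using this
  · have hlim : Tendsto (fun k : ℕ => ‖h (t + k)‖) atTop (𝓝 0) := by
      rw [← Nat.cofinite_eq_atTop]
      refine tendsto_zero_iff_norm_tendsto_zero.1 (hh.comp ?_)
      exact Function.Injective.tendsto_cofinite fun a b hab => by simpa using hab
    have := ge_of_tendsto' hlim fun k => show ‖h t‖ ≤ _ by
      have := hpow k (t + k)
      rw [add_sub_cancel_right] at this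
      rw [this, norm_mul, norm_pow]
      exact mul_le_of_le_one_left (norm_nonneg _) (pow_le_one₀ (norm_nonneg _) h1)
    simpa using this

/-- A nonzero filter is injective on sequences vanishing at infinity, even if it has zeros on the
unit circle. -/
lemma eq_zero_of_lagFilter_eq_zero {A : Polynomial ℝ} (hA : A ≠ 0) {h : ℤ → ℝ}
    (hh : Tendsto h cofinite (𝓝 0)) (h0 : lagFilter A h = 0) : h = 0 := by
  have aux : ∀ (m : Multiset ℂ) (h : ℤ → ℂ), Tendsto h cofinite (𝓝 0) →
      lagFilter (m.map fun z => Polynomial.X - Polynomial.C z).prod h = 0 → h = 0 := by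
    intro m
    induction m using Multiset.induction_on with
    | empty => exact fun h _ h0 => by simpa [lagFilter] using h0
    | cons z m ih =>
      intro h hh h0
      rw [Multiset.map_cons, Multiset.prod_cons, mul_comm, lagFilter_mul] at h0
      refine eq_zero_of_lagFilter_X_sub_C hh (ih _ ?_ h0)
      have h1 : Tendsto (fun t : ℤ => h (t - 1)) cofinite (𝓝 0) :=
        hh.comp (sub_left_injective (b := (1 : ℤ))).tendsto_cofinite
      simpa [funext (lagFilter_X_sub_C_apply z h)] using h1.sub (hh.const_mul z)
  have hc : (fun s => (h s : ℂ)) = 0 := by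
    have hA' := (Polynomial.map_ne_zero_iff Complex.ofRealHom.injective).2 hA
    refine aux (A.map Complex.ofRealHom).roots _ ?_ ?_
    · exact Tendsto.comp (by simpa using Complex.continuous_ofReal.tendsto 0) hh
    · have h1 : lagFilter (A.map Complex.ofRealHom) (fun s => (h s : ℂ)) = 0 := by
        ext t
        simp [lagFilter_map_ofReal, h0]
      rw [(IsAlgClosed.splits (A.map Complex.ofRealHom)).eq_prod_roots, lagFilter_mul] at h1
      ext t
      have := congrFun h1 t
      simpa [lagFilter, hA] using this
  ext s
  simpa using congrFun hc s

/-! ### The central limit theorem for the innovations -/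

lemma tendsto_one_div_sqrt_natCast : Tendsto (fun n : ℕ => 1 / √(n : ℝ)) atTop (𝓝 0) := by
  simpa [Function.comp_def] using tendsto_inv_atTop_zero.comp
    (Real.tendsto_sqrt_atTop.comp tendsto_natCast_atTop_atTop)

lemma norm_prod_sub_prod_le {ι : Type*} (I : Finset ι) {f g : ι → ℂ} (hf : ∀ i ∈ I, ‖f i‖ ≤ 1)
    (hg : ∀ i ∈ I, ‖g i‖ ≤ 1) :
    ‖∏ i ∈ I, f i - ∏ i ∈ I, g i‖ ≤ ∑ i ∈ I, ‖f i - g i‖ := by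
  classical
  induction I using Finset.induction_on with
  | empty => simp
  | insert i I hi ih =>
    rw [Finset.prod_insert hi, Finset.prod_insert hi, Finset.sum_insert hi]
    have hP : ‖∏ j ∈ I, f j‖ ≤ 1 := by
      rw [norm_prod]
      exact Finset.prod_le_one (fun _ _ => norm_nonneg _)
        fun j hj => hf j (Finset.mem_insert_of_mem hj)
    calc ‖f i * ∏ j ∈ I, f j - g i * ∏ j ∈ I, g j‖
        = ‖(f i - g i) * ∏ j ∈ I, f j + g i * (∏ j ∈ I, f j - ∏ j ∈ I, g j)‖ := by ring_nf
      _ ≤ ‖f i - g i‖ * ‖∏ j ∈ I, f j‖ + ‖g i‖ * ‖∏ j ∈ I, f j - ∏ j ∈ I, g j‖ := by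
        refine (norm_add_le _ _).trans ?_
        rw [norm_mul, norm_mul]
      _ ≤ ‖f i - g i‖ * 1 + 1 * ∑ j ∈ I, ‖f j - g j‖ := by
        gcongr
        · exact hg i (Finset.mem_insert_self _ _)
        · exact ih (fun j hj => hf j (Finset.mem_insert_of_mem hj))
            fun j hj => hg j (Finset.mem_insert_of_mem hj)
      _ = _ := by ring

lemma norm_exp_mul_I_sub_taylor_le (x : ℝ) :
    ‖Complex.exp (x * Complex.I) - (1 + x * Complex.I - (x : ℂ) ^ 2 / 2)‖ ≤ 4 * |x| ^ 3 := by
  rcases le_total |x| 1 with hx | hx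
  · have hn : ‖(x : ℂ) * Complex.I‖ = |x| := by simp
    have h := Complex.exp_bound (x := x * Complex.I) (by rwa [hn]) (n := 3) (by norm_num)
    rw [hn] at h
    have e : ∑ m ∈ Finset.range 3, ((x : ℂ) * Complex.I) ^ m / (m.factorial : ℂ) =
        1 + x * Complex.I - (x : ℂ) ^ 2 / 2 := by
      simp [Finset.sum_range_succ, mul_pow, Nat.factorial]
      ring
    rw [e] at h
    refine h.trans ?_
    rw [mul_comm]
    gcongr
    norm_num [Nat.factorial]
  · calc ‖Complex.exp (x * Complex.I) - (1 + x * Complex.I - (x : ℂ) ^ 2 / 2)‖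
        ≤ ‖Complex.exp (x * Complex.I)‖ + (‖(1 : ℂ)‖ + ‖x * Complex.I‖ + ‖(x : ℂ) ^ 2 / 2‖) := by
          refine (norm_sub_le _ _).trans ?_
          gcongr
          refine (norm_sub_le _ _).trans ?_
          gcongr
          exact norm_add_le _ _
      _ = 1 + (1 + |x| + |x| ^ 2 / 2) := by
          rw [Complex.norm_exp_ofReal_mul_I]
          simp
      _ ≤ 4 * |x| ^ 3 := by
          have h2 : |x| ≤ |x| ^ 3 := le_self_pow₀ hx (by norm_num)
          have h3 : |x| ^ 2 ≤ |x| ^ 3 := pow_le_pow_right₀ hx (by norm_num)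
          linarith

section

variable {Ω : Type*} [MeasurableSpace Ω] {P : Measure Ω} [IsProbabilityMeasure P]

lemma norm_charFun_sub_taylor_le {Z : Ω → ℝ} (hZ : MemLp Z 2 P)
    (h3 : Integrable (fun ω => |Z ω| ^ 3) P)
    (h0 : ∫ ω, Z ω ∂P = 0) (h1 : ∫ ω, Z ω ^ 2 ∂P = 1) (u : ℝ) :
    ‖charFun (P.map Z) u - (1 - (u : ℂ) ^ 2 / 2)‖ ≤ 4 * |u| ^ 3 * ∫ ω, |Z ω| ^ 3 ∂P := by
  have hm : AEMeasurable Z P := hZ.1.aemeasurable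
  have hi1 : Integrable (fun ω => (((u * Z ω : ℝ) : ℂ)) * Complex.I) P :=
    (((hZ.integrable one_le_two).const_mul u).ofReal).mul_const _
  have hi2 : Integrable (fun ω => ((((u * Z ω) ^ 2 / 2 : ℝ)) : ℂ)) P := by
    have h : Integrable (fun ω => (u * Z ω) ^ 2 / 2) P := by
      simpa only [mul_pow, mul_div_right_comm] using hZ.integrable_sq.const_mul (u ^ 2 / 2)
    exact h.ofReal
  have hi3 : Integrable (fun ω => 1 + (((u * Z ω : ℝ) : ℂ)) * Complex.I) P :=
    (integrable_const _).add hi1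
  have hi4 : Integrable (fun ω => 1 + (((u * Z ω : ℝ) : ℂ)) * Complex.I -
      (((u * Z ω) ^ 2 / 2 : ℝ) : ℂ)) P := hi3.sub hi2
  have hie : Integrable (fun ω => Complex.exp ((u * Z ω : ℝ) * Complex.I)) P := by
    refine Integrable.of_bound (C := 1) ?_ (ae_of_all _ fun ω => ?_)
    · exact (Complex.measurable_exp.comp_aemeasurable
        ((Complex.measurable_ofReal.comp_aemeasurable (hm.const_mul u)).mul_const
          _)).aestronglyMeasurable
    · rw [Complex.norm_exp_ofReal_mul_I]
  have e1 : charFun (P.map Z) u = ∫ ω, Complex.exp ((u * Z ω : ℝ) * Complex.I) ∂P := by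
    rw [charFun_apply_real, integral_map hm (by fun_prop)]
    simp
  have e2 : (1 - (u : ℂ) ^ 2 / 2) = ∫ ω, (1 + ((u * Z ω : ℝ) : ℂ) * Complex.I -
      (((u * Z ω) ^ 2 / 2 : ℝ) : ℂ)) ∂P := by
    rw [integral_sub hi3 hi2, integral_add (integrable_const _) hi1,
      integral_mul_const, integral_complex_ofReal, integral_complex_ofReal, integral_const_mul, h0,
      integral_div]
    simp_rw [mul_pow]
    rw [integral_const_mul, h1]
    simp
  rw [e1, e2, ← integral_sub hie hi4, ← integral_const_mul]
  refine norm_integral_le_of_norm_le (h3.const_mul _) (ae_of_all _ fun ω => ?_)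
  have := norm_exp_mul_I_sub_taylor_le (u * Z ω)
  rw [abs_mul, mul_pow] at this
  push_cast at this ⊢
  linarith

/-- Lyapunov's central limit theorem for unit variances and uniformly bounded third moments, in
terms of characteristic functions: each of the `n` factors is `exp (-u ^ 2 / (2 * n))` up to
`O(n ^ (-3 / 2))`. -/
lemma tendsto_charFun_normalizedSum {Y : ℤ → Ω → ℝ} (hindep : iIndepFun Y P)
    (hL2 : ∀ t, MemLp (Y t) 2 P) (hmean : ∀ t, ∫ ω, Y t ω ∂P = 0)
    (hvar : ∀ t, ∫ ω, Y t ω ^ 2 ∂P = 1) {M : ℝ}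
    (h3 : ∀ t, Integrable (fun ω => |Y t ω| ^ 3) P ∧ ∫ ω, |Y t ω| ^ 3 ∂P ≤ M) (u : ℝ) :
    Tendsto (fun n : ℕ => charFun (P.map (normalizedSum Y n)) u) atTop
      (𝓝 (Complex.exp (-(u : ℂ) ^ 2 / 2))) := by
  have hm : ∀ t, AEMeasurable (Y t) P := fun t => (hL2 t).1.aemeasurable
  have hM : 0 ≤ M := (integral_nonneg fun ω => by positivity).trans (h3 0).2
  have hprod : ∀ n : ℕ, charFun (P.map (normalizedSum Y n)) u =
      ∏ t ∈ Finset.Icc (1 : ℤ) n, charFun (P.map (Y t)) (1 / √n * u) := by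
    intro n
    unfold normalizedSum
    rw [charFun_map_mul_comp (Finset.aemeasurable_fun_sum _ fun t _ => hm t),
      (hindep.restrict _).charFun_map_fun_finsetSum_eq_prod fun t _ => hm t]
    simp
  have hbound : ∀ᶠ n : ℕ in atTop,
      ‖charFun (P.map (normalizedSum Y n)) u - Complex.exp (-(u : ℂ) ^ 2 / 2)‖ ≤
        4 * |u| ^ 3 * M * (1 / √n) + u ^ 4 * (1 / n) := by
    filter_upwards [eventually_ge_atTop 1, eventually_ge_atTop ⌈u ^ 2⌉₊] with n hn1 hnu
    have hn0 : (0 : ℝ) < n := by exact_mod_cast hn1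
    have hs : √(n : ℝ) ^ 2 = n := Real.sq_sqrt hn0.le
    have hs0 : 0 < √(n : ℝ) := Real.sqrt_pos.2 hn0
    have hcard : (Finset.Icc (1 : ℤ) n).card = n := by simp
    have he : Complex.exp (-(u : ℂ) ^ 2 / 2) =
        ∏ t ∈ Finset.Icc (1 : ℤ) n, ((Real.exp (-(u ^ 2 / (2 * n))) : ℝ) : ℂ) := by
      rw [Finset.prod_const, hcard, Complex.ofReal_exp, ← Complex.exp_nat_mul]
      push_cast
      congr 1
      have : (n : ℂ) ≠ 0 := by exact_mod_cast hn0.ne'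
      field_simp
    have hone : ∀ t : ℤ, ‖charFun (P.map (Y t)) (1 / √n * u) -
        ((Real.exp (-(u ^ 2 / (2 * n))) : ℝ) : ℂ)‖ ≤
          4 * |u| ^ 3 * M * (1 / √n) / n + u ^ 4 * (1 / n) / n := by
      intro t
      have a1 := norm_charFun_sub_taylor_le (hL2 t) (h3 t).1 (hmean t) (hvar t) (1 / √n * u)
      have hx : ‖-(u ^ 2 / (2 * n))‖ ≤ 1 := by
        rw [norm_neg, Real.norm_of_nonneg (by positivity), div_le_one (by positivity)]
        have := Nat.ceil_le.1 hnu
        nlinarith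
      have a2 := Real.norm_exp_sub_one_sub_id_le hx
      have e : ((1 : ℂ) - ((1 / √n * u : ℝ) : ℂ) ^ 2 / 2) = ((1 - u ^ 2 / (2 * n) : ℝ) : ℂ) := by
        rw [← Complex.ofReal_pow, mul_pow, div_pow, hs]
        push_cast
        ring
      rw [e] at a1
      have a3 : ‖((1 - u ^ 2 / (2 * n) : ℝ) : ℂ) - ((Real.exp (-(u ^ 2 / (2 * n))) : ℝ) : ℂ)‖ ≤
          u ^ 4 * (1 / n) / n := by
        rw [← Complex.ofReal_sub, Complex.norm_real, norm_sub_rev]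
        calc _ = ‖Real.exp (-(u ^ 2 / (2 * n))) - 1 - -(u ^ 2 / (2 * n))‖ := by congr 1; ring
          _ ≤ ‖-(u ^ 2 / (2 * n))‖ ^ 2 := a2
          _ = u ^ 4 * (1 / n) / n / 4 := by
            rw [norm_neg, Real.norm_of_nonneg (by positivity)]
            field_simp
            ring
          _ ≤ _ := by
            have : 0 ≤ u ^ 4 * (1 / n) / n := by positivity
            linarith
      have a4 : 4 * |1 / √n * u| ^ 3 * ∫ ω, |Y t ω| ^ 3 ∂P ≤ 4 * |u| ^ 3 * M * (1 / √n) / n := by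
        calc _ ≤ 4 * |1 / √n * u| ^ 3 * M := by
              gcongr
              exact (h3 t).2
          _ = 4 * |u| ^ 3 * M * (1 / √n) / √n ^ 2 := by
              rw [abs_mul, abs_of_pos (by positivity : 0 < 1 / √(n : ℝ))]
              field_simp
          _ = _ := by rw [hs]
      calc _ ≤ _ := norm_sub_le_norm_sub_add_norm_sub _ ((1 - u ^ 2 / (2 * n) : ℝ) : ℂ) _
        _ ≤ _ := add_le_add (a1.trans a4) a3
    have := fun t => Measure.isProbabilityMeasure_map (hm t)
    rw [hprod, he]
    refine (norm_prod_sub_prod_le _ (fun t _ => norm_charFun_le_one _) fun t _ => ?_).trans ?_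
    · rw [Complex.norm_real, Real.norm_of_nonneg (Real.exp_pos _).le, Real.exp_le_one_iff,
        neg_nonpos]
      positivity
    · refine (Finset.sum_le_sum fun t _ => hone t).trans_eq ?_
      rw [Finset.sum_const, hcard, nsmul_eq_mul]
      field_simp
  rw [tendsto_iff_norm_sub_tendsto_zero]
  refine squeeze_zero' (Eventually.of_forall fun _ => norm_nonneg _) hbound ?_
  simpa using (tendsto_one_div_sqrt_natCast.const_mul (4 * |u| ^ 3 * M)).add
    (tendsto_one_div_atTop_nhds_zero_nat.const_mul (u ^ 4))

lemma tendstoInDistribution_const_mul_normalizedSum {Y : ℤ → Ω → ℝ} (hindep : iIndepFun Y P)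
    (hL2 : ∀ t, MemLp (Y t) 2 P) (hmean : ∀ t, ∫ ω, Y t ω ∂P = 0)
    (hvar : ∀ t, ∫ ω, Y t ω ^ 2 ∂P = 1) {M : ℝ}
    (h3 : ∀ t, Integrable (fun ω => |Y t ω| ^ 3) P ∧ ∫ ω, |Y t ω| ^ 3 ∂P ≤ M)
    (m : ℝ) (v : ℝ≥0) (hv : (v : ℝ) = m ^ 2) :
    TendstoInDistribution (fun (n : ℕ) ω => m * normalizedSum Y n ω) atTop (id : ℝ → ℝ)
      (fun _ => P) (gaussianReal 0 v) := by
  have hm : ∀ t, AEMeasurable (Y t) P := fun t => (hL2 t).1.aemeasurable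
  have hS : ∀ n : ℕ, AEMeasurable (normalizedSum Y n) P := fun n =>
    (Finset.aemeasurable_fun_sum _ fun t _ => hm t).const_mul _
  refine ⟨fun n => (hS n).const_mul _, aemeasurable_id, ?_⟩
  refine ProbabilityMeasure.tendsto_iff_tendsto_charFun.2 fun u => ?_
  have := tendsto_charFun_normalizedSum hindep hL2 hmean hvar h3 (m * u)
  simp only [ProbabilityMeasure.coe_mk, charFun_map_mul_comp (hS _), Measure.map_id,
    charFun_gaussianReal]
  convert! this using 2
  rw [← Complex.ofReal_inj] at hv
  push_cast at hv ⊢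
  rw [hv]
  ring_nf

end

/-! ### The limit of the averaged covariances -/

lemma sum_Icc_one_int_eq_sum_range {M : Type*} [AddCommMonoid M] (f : ℤ → M) (n : ℕ) :
    ∑ t ∈ Finset.Icc (1 : ℤ) n, f t = ∑ i ∈ Finset.range n, f (i + 1) := by
  refine Finset.sum_nbij' (fun t => (t - 1).toNat) (fun i => (i : ℤ) + 1) ?_ ?_ ?_ ?_ ?_
  · intro t ht
    simp only [Finset.mem_Icc, Finset.mem_range] at ht ⊢
    omega
  · intro i hi
    simp only [Finset.mem_Icc, Finset.mem_range] at hi ⊢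
    omega
  · intro t ht
    simp only [Finset.mem_Icc] at ht
    omega
  · intro i _
    omega
  · intro t ht
    simp only [Finset.mem_Icc] at ht
    congr 1
    omega

/-- Cesàro averages of a summable Toeplitz array: the increment of the double sum from `n` to
`n + 1` is `∑_{|k| ≤ n} γ k`. -/
lemma HasSum.tendsto_average_sub {γ : ℤ → ℝ} {L : ℝ} (hγ : HasSum γ L) :
    Tendsto (fun n : ℕ => 1 / (n : ℝ) * ∑ t ∈ Finset.Icc (1 : ℤ) n, ∑ t' ∈ Finset.Icc (1 : ℤ) n,
      γ (t - t')) atTop (𝓝 L) := by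
  set a : ℕ → ℝ := fun n => ∑ j ∈ Finset.range n, (γ j + γ (-(j + 1))) + γ n with ha
  have hS : ∀ n : ℕ, ∑ t ∈ Finset.Icc (1 : ℤ) n, ∑ t' ∈ Finset.Icc (1 : ℤ) n, γ (t - t') =
      ∑ m ∈ Finset.range n, a m := by
    intro n
    simp only [sum_Icc_one_int_eq_sum_range, add_sub_add_right_eq_sub]
    induction n with
    | zero => simp
    | succ n ih =>
      rw [Finset.sum_range_succ, Finset.sum_range_succ a, ← ih]
      have e1 : ∑ j ∈ Finset.range (n + 1), γ ((n : ℤ) - j) = ∑ j ∈ Finset.range (n + 1), γ j := by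
        rw [← Finset.sum_range_reflect (fun j : ℕ => γ j)]
        refine Finset.sum_congr rfl fun j hj => ?_
        have := Finset.mem_range.1 hj
        congr 1
        omega
      have e2 : ∑ i ∈ Finset.range n, γ ((i : ℤ) - n) =
          ∑ j ∈ Finset.range n, γ (-((j : ℤ) + 1)) := by
        rw [← Finset.sum_range_reflect]
        refine Finset.sum_congr rfl fun j hj => ?_
        have := Finset.mem_range.1 hj
        congr 1
        omega
      rw [e1]
      simp only [Finset.sum_range_succ _ n, Finset.sum_add_distrib, e2, ha]
      ring
  have hlim : Tendsto a atTop (𝓝 L) := by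
    have h1 := hγ.nat_add_neg_add_one.tendsto_sum_nat
    have h2 : Tendsto (fun n : ℕ => γ n) atTop (𝓝 0) := by
      rw [← Nat.cofinite_eq_atTop]
      exact hγ.summable.tendsto_cofinite_zero.comp Nat.cast_injective.tendsto_cofinite
    simpa only [add_zero] using h1.add h2
  simpa only [hS, one_div] using hlim.cesaro

lemma summable_mul_comp_sub {c : ℤ → ℝ} (hc : Summable fun s => |c s|) (t t' : ℤ) :
    Summable fun s : ℤ => c (t - s) * c (t' - s) := by
  have h1 := summable_mul_of_summable_norm (f := c) (g := c) (by simpa using hc) (by simpa using hc)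
  refine h1.comp_injective (i := fun s : ℤ => (t - s, t' - s)) fun x y hxy => ?_
  simpa using congrArg Prod.fst hxy

lemma tendsto_averagedCovariance {c : ℤ → ℝ} (hc : Summable fun s => |c s|) :
    Tendsto (averagedCovariance c) atTop (𝓝 ((∑' s, c s) ^ 2)) := by
  have hcn : Summable fun s => ‖c s‖ := by simpa using hc
  let e : ℤ × ℤ ≃ ℤ × ℤ :=
    ⟨fun x => (x.1 + x.2, x.2), fun x => (x.1 - x.2, x.2), fun x => by simp, fun x => by simp⟩
  have hprod : HasSum (fun x : ℤ × ℤ => c (x.1 + x.2) * c x.2) ((∑' s, c s) ^ 2) := by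
    have h := (summable_mul_of_summable_norm hcn hcn).hasSum
    rw [← tsum_mul_tsum_of_summable_norm hcn hcn, ← sq] at h
    exact e.hasSum_iff.2 h
  have hγ : HasSum (fun k : ℤ => ∑' s : ℤ, c (k + s) * c s) ((∑' s, c s) ^ 2) :=
    hprod.prod_fiberwise fun k => (hprod.summable.prod_factor k).hasSum
  have hrw : ∀ t t' : ℤ, ∑' s : ℤ, c (t - s) * c (t' - s) = ∑' s : ℤ, c (t - t' + s) * c s := by
    intro t t'
    rw [← (Equiv.subLeft t').tsum_eq fun s => c (t - t' + s) * c s]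
    refine tsum_congr fun s => ?_
    simp
  have := hγ.tendsto_average_sub
  unfold averagedCovariance
  simpa only [hrw] using this

/-! ### Moving averages of bounded sequences in `L¹` -/

section MovingAverage

variable {Ω : Type*} [MeasurableSpace Ω] {P : Measure Ω}

lemma eLpNorm_one_const_mul (a : ℝ) (W : Ω → ℝ) :
    eLpNorm (fun ω => a * W ω) 1 P = ‖a‖ₑ * eLpNorm W 1 P := by
  exact eLpNorm_const_smul a W 1 P

lemma eLpNorm_one_tsum_mul_le {W : ℤ → Ω → ℝ} (hW : ∀ s, AEStronglyMeasurable (W s) P)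
    (c : ℤ → ℝ) :
    eLpNorm (fun ω => ∑' s, c s * W s ω) 1 P ≤ ∑' s, ‖c s‖ₑ * eLpNorm (W s) 1 P := by
  simp only [← eLpNorm_one_const_mul]
  simp only [eLpNorm_one_eq_lintegral_enorm]
  rw [← lintegral_tsum fun s => ((hW s).const_mul (c s)).enorm]
  exact lintegral_mono fun ω => enorm_tsum_le_tsum_enorm

lemma ae_summable_mul {W : ℤ → Ω → ℝ} (hW : ∀ s, AEStronglyMeasurable (W s) P) {K : ℝ≥0}
    (hK : ∀ s, eLpNorm (W s) 1 P ≤ K) {c : ℤ → ℝ} (hc : Summable fun s => |c s|) :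
    ∀ᵐ ω ∂P, Summable fun s => c s * W s ω := by
  have h := summable_norm_of_tsum_eLpNorm_ne_top (μ := P) le_rfl
    (f := fun s ω => c s * W s ω) (fun s => (hW s).const_mul (c s)) ?_
  · filter_upwards [h] with ω hω using hω.of_norm
  · simp only [eLpNorm_one_const_mul]
    refine ne_top_of_le_ne_top ?_ (ENNReal.tsum_le_tsum fun s => mul_le_mul_right (hK s) _)
    rw [ENNReal.tsum_mul_right]
    exact ENNReal.mul_ne_top (tsum_enorm_ne_top_iff_summable_norm.2 (by simpa using hc))
      ENNReal.coe_ne_top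

lemma ae_summable_convolution {Y : ℤ → Ω → ℝ} (hY : ∀ t, AEStronglyMeasurable (Y t) P) {K : ℝ≥0}
    (hK : ∀ t, eLpNorm (Y t) 1 P ≤ K) {c : ℤ → ℝ} (hc : Summable fun s => |c s|) :
    ∀ᵐ ω ∂P, ∀ t, Summable fun s => c s * Y (t - s) ω :=
  ae_all_iff.2 fun t => ae_summable_mul (fun s => hY (t - s)) (fun s => hK (t - s)) hc

lemma eLpNorm_one_le_of_integral_sq_le [IsProbabilityMeasure P] {X : Ω → ℝ} (hX : MemLp X 2 P)
    {K : ℝ} (hK : ∫ ω, X ω ^ 2 ∂P ≤ K) : eLpNorm X 1 P ≤ (1 + K).toNNReal := by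
  have hi := hX.integrable one_le_two
  rw [eLpNorm_one_eq_lintegral_enorm, ← ofReal_integral_norm_eq_lintegral_enorm hi]
  refine ENNReal.ofReal_le_ofReal ?_
  calc ∫ ω, ‖X ω‖ ∂P ≤ ∫ ω, (1 + X ω ^ 2) ∂P := by
        refine integral_mono hi.norm ((integrable_const 1).add hX.integrable_sq) fun ω => ?_
        change |X ω| ≤ 1 + X ω ^ 2
        nlinarith [sq_abs (X ω), sq_nonneg (|X ω| - 1 / 2)]
    _ = 1 + ∫ ω, X ω ^ 2 ∂P := by
        rw [integral_add (integrable_const 1) hX.integrable_sq]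
        simp
    _ ≤ 1 + K := by linarith

lemma eLpNorm_one_sum_le_card {Y : ℤ → Ω → ℝ} (hY : ∀ t, AEStronglyMeasurable (Y t) P) {K : ℝ≥0}
    (hK : ∀ t, eLpNorm (Y t) 1 P ≤ K) (I : Finset ℤ) {m : ℕ} (hI : I.card ≤ m) :
    eLpNorm (fun ω => ∑ t ∈ I, Y t ω) 1 P ≤ m * K := by
  have e : (fun ω => ∑ t ∈ I, Y t ω) = ∑ t ∈ I, Y t := by
    ext ω
    simp
  rw [e]
  refine (eLpNorm_sum_le (fun t _ => hY t) le_rfl).trans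
    ((Finset.sum_le_sum fun t _ => hK t).trans ?_)
  rw [Finset.sum_const, nsmul_eq_mul]
  gcongr

/-- Shifting a window by `s` changes at most `|s|` terms on each side. -/
lemma eLpNorm_one_window_sub_le {Y : ℤ → Ω → ℝ} (hY : ∀ t, AEStronglyMeasurable (Y t) P) {K : ℝ≥0}
    (hK : ∀ t, eLpNorm (Y t) 1 P ≤ K) (n : ℕ) (s : ℤ) :
    eLpNorm (fun ω => ∑ t ∈ Finset.Icc (1 : ℤ) n, Y (t - s) ω - ∑ t ∈ Finset.Icc (1 : ℤ) n, Y t ω)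
      1 P ≤ 2 * (s.natAbs * K) := by
  have e : (fun ω => ∑ t ∈ Finset.Icc (1 : ℤ) n, Y (t - s) ω -
      ∑ t ∈ Finset.Icc (1 : ℤ) n, Y t ω) =
      (fun ω => ∑ t ∈ Finset.Icc (1 - s) (n - s) \ Finset.Icc (1 : ℤ) n, Y t ω) -
        fun ω => ∑ t ∈ Finset.Icc (1 : ℤ) n \ Finset.Icc (1 - s) (n - s), Y t ω := by
    ext ω
    rw [Pi.sub_apply, Finset.sum_sdiff_sub_sum_sdiff]
    congr 1
    refine Finset.sum_nbij' (fun t => t - s) (fun t => t + s) ?_ ?_ ?_ ?_ ?_ <;>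
      intro t <;> simp only [Finset.mem_Icc] <;> intros <;> first | omega | trivial
  have c1 : (Finset.Icc (1 - s) (n - s) \ Finset.Icc (1 : ℤ) n).card ≤ s.natAbs := by
    have : Finset.Icc (1 - s) (n - s) \ Finset.Icc (1 : ℤ) n ⊆
        Finset.Icc (1 - s) 0 ∪ Finset.Icc (n + 1 : ℤ) (n - s) := by
      intro t
      simp only [Finset.mem_sdiff, Finset.mem_union, Finset.mem_Icc]
      omega
    refine (Finset.card_le_card this).trans ((Finset.card_union_le _ _).trans ?_)
    simp only [Int.card_Icc]
    omega
  have c2 : (Finset.Icc (1 : ℤ) n \ Finset.Icc (1 - s) (n - s)).card ≤ s.natAbs := by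
    have : Finset.Icc (1 : ℤ) n \ Finset.Icc (1 - s) (n - s) ⊆
        Finset.Icc (1 : ℤ) (-s) ∪ Finset.Icc (n - s + 1 : ℤ) n := by
      intro t
      simp only [Finset.mem_sdiff, Finset.mem_union, Finset.mem_Icc]
      omega
    refine (Finset.card_le_card this).trans ((Finset.card_union_le _ _).trans ?_)
    simp only [Int.card_Icc]
    omega
  rw [e, two_mul]
  exact (eLpNorm_sub_le (Finset.aestronglyMeasurable_fun_sum _ fun t _ => hY t)
    (Finset.aestronglyMeasurable_fun_sum _ fun t _ => hY t) le_rfl).trans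
    (add_le_add (eLpNorm_one_sum_le_card hY hK _ c1) (eLpNorm_one_sum_le_card hY hK _ c2))

lemma measurable_maProcess {Y : ℤ → Ω → ℝ} (hY : ∀ t, Measurable (Y t)) (c : ℤ → ℝ) (t : ℤ) :
    Measurable (maProcess c Y t) :=
  Measurable.tsum fun s => (hY (t - s)).const_mul (c s)

/-- The remainder in `∑ X_t = (∑ c_s) ∑ Y_t + O(1)` (a Beveridge–Nelson type decomposition)
disappears after division by `√n`. -/
lemma tendstoInMeasure_normalizedSum_maProcess_sub {Y : ℤ → Ω → ℝ} (hY : ∀ t, Measurable (Y t))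
    {K : ℝ≥0} (hK : ∀ t, eLpNorm (Y t) 1 P ≤ K) {c : ℤ → ℝ} (hc : Summable fun s => |c s|)
    (hc1 : Summable fun s : ℤ => |(s : ℝ)| * |c s|) :
    TendstoInMeasure P ((fun n : ℕ => normalizedSum (maProcess c Y) n) -
      fun (n : ℕ) ω => (∑' s, c s) * normalizedSum Y n ω) atTop 0 := by
  have hYs : ∀ t, AEStronglyMeasurable (Y t) P := fun t => (hY t).aestronglyMeasurable
  set W : ℕ → ℤ → Ω → ℝ := fun n s ω =>
    ∑ t ∈ Finset.Icc (1 : ℤ) n, Y (t - s) ω - ∑ t ∈ Finset.Icc (1 : ℤ) n, Y t ω with hW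
  have hWm : ∀ n s, AEStronglyMeasurable (W n s) P := fun n s =>
    ((Finset.measurable_fun_sum _ fun t _ => hY (t - s)).sub
      (Finset.measurable_fun_sum _ fun t _ => hY t)).aestronglyMeasurable
  have hmeas : ∀ n : ℕ, Measurable (normalizedSum (maProcess c Y) n) := fun n =>
    (Finset.measurable_fun_sum _ fun t _ => measurable_maProcess hY c t).const_mul _
  have hmeas' : ∀ n : ℕ, Measurable (normalizedSum Y n) := fun n =>
    (Finset.measurable_fun_sum _ fun t _ => hY t).const_mul _
  refine tendstoInMeasure_of_tendsto_eLpNorm one_ne_zero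
    (fun n => ((hmeas n).sub ((hmeas' n).const_mul _)).aestronglyMeasurable)
    aestronglyMeasurable_zero ?_
  have hc' : Summable c := hc.of_abs
  have hae : ∀ n : ℕ, (((fun n : ℕ => normalizedSum (maProcess c Y) n) -
      fun (n : ℕ) ω => (∑' s, c s) * normalizedSum Y n ω) n - 0 : Ω → ℝ) =ᵐ[P]
        fun ω => 1 / √n * ∑' s, c s * W n s ω := by
    intro n
    filter_upwards [ae_summable_convolution hYs hK hc] with ω hω
    have h1 : HasSum (fun s => ∑ t ∈ Finset.Icc (1 : ℤ) n, c s * Y (t - s) ω)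
        (∑ t ∈ Finset.Icc (1 : ℤ) n, maProcess c Y t ω) := hasSum_sum fun t _ => (hω t).hasSum
    have h2 := h1.sub (hc'.hasSum.mul_right (∑ t ∈ Finset.Icc (1 : ℤ) n, Y t ω))
    simp only [← Finset.mul_sum, ← mul_sub] at h2
    rw [h2.tsum_eq]
    simp only [Pi.sub_apply, normalizedSum, Pi.zero_apply]
    ring
  have hbound : ∀ n : ℕ, eLpNorm (((fun n : ℕ => normalizedSum (maProcess c Y) n) -
      fun (n : ℕ) ω => (∑' s, c s) * normalizedSum Y n ω) n - 0) 1 P ≤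
        ENNReal.ofReal (1 / √n) * ∑' s : ℤ, ‖c s‖ₑ * (2 * (s.natAbs * K)) := by
    intro n
    rw [eLpNorm_congr_ae (hae n), eLpNorm_one_const_mul, Real.enorm_of_nonneg (by positivity)]
    gcongr
    exact (eLpNorm_one_tsum_mul_le (hWm n) c).trans (ENNReal.tsum_le_tsum fun s =>
      mul_le_mul_right (eLpNorm_one_window_sub_le hYs hK n s) _)
  have hfin : ∑' s : ℤ, ‖c s‖ₑ * (2 * (s.natAbs * K)) ≠ ⊤ := by
    have e : ∀ s : ℤ, ‖c s‖ₑ * (2 * (s.natAbs * (K : ENNReal))) =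
        ‖|(s : ℝ)| * |c s|‖ₑ * (2 * K) := by
      intro s
      have : (s.natAbs : ENNReal) = ‖(s : ℝ)‖ₑ := by
        rw [Real.enorm_eq_ofReal_abs, ← Int.cast_abs, ← Nat.cast_natAbs, ENNReal.ofReal_natCast]
      rw [enorm_mul, Real.enorm_abs, Real.enorm_abs, this]
      ring
    simp only [e]
    rw [ENNReal.tsum_mul_right]
    exact ENNReal.mul_ne_top (tsum_enorm_ne_top_iff_summable_norm.2 hc1.norm)
      (ENNReal.mul_ne_top (by simp) ENNReal.coe_ne_top)
  refine tendsto_of_tendsto_of_tendsto_of_le_of_le tendsto_const_nhds ?_ (fun _ => zero_le) hbound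
  have l2 := ENNReal.Tendsto.mul_const (ENNReal.tendsto_ofReal tendsto_one_div_sqrt_natCast)
    (Or.inr hfin)
  simpa using l2

end MovingAverage

/-! ### ARMA equations for moving averages -/

lemma GeomDecay.summable_pow_mul_abs {c : ℤ → ℝ} (hc : GeomDecay c) (k : ℕ) :
    Summable fun s : ℤ => |(s : ℝ)| ^ k * |c s| := by
  obtain ⟨C, r, h0, h1, hb⟩ := hc
  have hnat : Summable fun n : ℕ => (n : ℝ) ^ k * (C * r ^ n) := by
    simpa only [mul_left_comm] using (summable_pow_mul_geometric_of_norm_lt_one k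
      (by rwa [Real.norm_of_nonneg h0.le] : ‖r‖ < 1)).mul_left C
  refine Summable.of_nat_of_neg (Summable.of_nonneg_of_le (fun n => by positivity)
    (fun n => ?_) hnat)
    (Summable.of_nonneg_of_le (fun n => by positivity) (fun n => ?_) hnat)
  · have := hb n
    simp only [Int.cast_natCast, Nat.abs_cast]
    gcongr
    simpa using this
  · have := hb (-n)
    simp only [Int.cast_neg, abs_neg, Int.cast_natCast, Nat.abs_cast]
    gcongr
    simpa using this

lemma GeomDecay.summable_abs {c : ℤ → ℝ} (hc : GeomDecay c) : Summable fun s => |c s| := by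
  simpa using hc.summable_pow_mul_abs 0

lemma summable_abs_lagFilter {c : ℤ → ℝ} (hc : Summable fun s => |c s|) (A : Polynomial ℝ) :
    Summable fun s => |lagFilter A c s| := by
  rw [summable_abs_iff] at hc ⊢
  rw [show lagFilter A c = _ from funext fun t => lagFilter_eq_sum_range (Nat.lt_succ_self _) c t]
  exact summable_sum fun i _ =>
    (hc.comp_injective (sub_left_injective (b := (i : ℤ)))).mul_left _

lemma hasSum_single_mul (y : ℤ → ℝ) (t : ℤ) :
    HasSum (fun s => (Pi.single 0 1 : ℤ → ℝ) s * y (t - s)) (y t) := by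
  convert hasSum_single (0 : ℤ) (f := fun s => (Pi.single 0 1 : ℤ → ℝ) s * y (t - s)) ?_ using 1
  · simp
  · intro s hs
    simp [hs]

section ARMA

variable {Ω : Type*} [MeasurableSpace Ω] {P : Measure Ω}

lemma isARMA_iff {p q : ℕ} {a b : ℕ → ℝ} {Y X : ℤ → Ω → ℝ} :
    IsARMA P p q a b Y X ↔ ∀ᵐ ω ∂P, ∀ t,
      lagFilter (lagPoly p a) (fun t => X t ω) t = lagFilter (lagPoly q b) (fun t => Y t ω) t := by
  rw [ae_all_iff]
  simp only [lagFilter_lagPoly_apply]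
  rfl

/-- The coefficients of an `ℓ¹` moving average of orthonormal variables are determined by it. -/
lemma eq_zero_of_ae_tsum_eq_zero {Y : ℤ → Ω → ℝ} (hindep : iIndepFun Y P)
    (hL2 : ∀ t, MemLp (Y t) 2 P) (hmean : ∀ t, ∫ ω, Y t ω ∂P = 0)
    (hvar : ∀ t, ∫ ω, Y t ω ^ 2 ∂P = 1) {e : ℤ → ℝ} (he : Summable fun s => |e s|)
    (h0 : ∀ᵐ ω ∂P, ∑' s, e s * Y (-s) ω = 0) : e = 0 := by
  ext u
  have hint : ∀ s, Integrable (fun ω => Y (-s) ω * Y (-u) ω) P := fun s =>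
    (hL2 (-s)).integrable_mul (hL2 (-u))
  have hval : ∀ s, ∫ ω, e s * Y (-s) ω * Y (-u) ω ∂P = if s = u then e u else 0 := by
    intro s
    simp only [mul_assoc]
    rw [integral_const_mul]
    split_ifs with hs
    · subst hs
      simp only [← sq, hvar, mul_one]
    · rw [(hindep.indepFun (by simpa using hs : -s ≠ -u)).integral_fun_mul_eq_mul_integral
        (hL2 _).1 (hL2 _).1, hmean]
      simp
  have hnorm : ∀ s, ∫ ω, ‖e s * Y (-s) ω * Y (-u) ω‖ ∂P ≤ |e s| := by
    intro s
    have h2 : ∫ ω, |Y (-s) ω * Y (-u) ω| ∂P ≤ 1 := by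
      calc ∫ ω, |Y (-s) ω * Y (-u) ω| ∂P
          ≤ ∫ ω, (1 / 2 * Y (-s) ω ^ 2 + 1 / 2 * Y (-u) ω ^ 2) ∂P := by
            refine integral_mono (hint s).abs (((hL2 _).integrable_sq.const_mul _).add
              ((hL2 _).integrable_sq.const_mul _)) fun ω => ?_
            simp only [abs_mul]
            nlinarith [sq_nonneg (|Y (-s) ω| - |Y (-u) ω|), sq_abs (Y (-s) ω), sq_abs (Y (-u) ω)]
        _ = 1 := by
            rw [integral_add ((hL2 _).integrable_sq.const_mul _)
              ((hL2 _).integrable_sq.const_mul _), integral_const_mul, integral_const_mul, hvar,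
              hvar]
            norm_num
    simp only [mul_assoc, norm_mul (e s)]
    rw [integral_const_mul]
    exact mul_le_of_le_one_right (norm_nonneg _) h2
  have hsum := hasSum_integral_of_summable_integral_norm (μ := P)
    (F := fun s ω => e s * Y (-s) ω * Y (-u) ω)
    (fun s => by simpa only [mul_assoc] using (hint s).const_mul (e s))
    (Summable.of_nonneg_of_le (fun s => integral_nonneg fun ω => norm_nonneg _) hnorm he)
  have hz : ∫ ω, ∑' s, e s * Y (-s) ω * Y (-u) ω ∂P = 0 := by
    rw [← integral_zero Ω ℝ (μ := P)]
    refine integral_congr_ae ?_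
    filter_upwards [h0] with ω hω
    rw [tsum_mul_right, hω, zero_mul]
  simp only [hval, hz] at hsum
  simpa using (hsum.unique (hasSum_ite_eq u (e u))).symm

/-- For `ℓ¹` moving averages the ARMA equations are equations between coefficient sequences. -/
lemma isARMA_maProcess_iff {Y : ℤ → Ω → ℝ} (hindep : iIndepFun Y P)
    (hL2 : ∀ t, MemLp (Y t) 2 P) (hmean : ∀ t, ∫ ω, Y t ω ∂P = 0)
    (hvar : ∀ t, ∫ ω, Y t ω ^ 2 ∂P = 1) {K : ℝ≥0} (hK : ∀ t, eLpNorm (Y t) 1 P ≤ K)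
    {p q : ℕ} {a b : ℕ → ℝ} {d : ℤ → ℝ} (hd : Summable fun s => |d s|) :
    IsARMA P p q a b Y (maProcess d Y) ↔
      lagFilter (lagPoly p a) d = lagFilter (lagPoly q b) (Pi.single 0 1 : ℤ → ℝ) := by
  have hleft : ∀ᵐ ω ∂P, ∀ t, HasSum (fun s => lagFilter (lagPoly p a) d s * Y (t - s) ω)
      (lagFilter (lagPoly p a) (fun t => maProcess d Y t ω) t) := by
    filter_upwards [ae_summable_convolution (fun t => (hL2 t).1) hK hd] with ω hω t
    exact hasSum_lagFilter_mul (lagPoly p a) (y := fun t => Y t ω) hω t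
  have hright : ∀ ω t,
      HasSum (fun s => lagFilter (lagPoly q b) (Pi.single 0 1 : ℤ → ℝ) s * Y (t - s) ω)
        (lagFilter (lagPoly q b) (fun t => Y t ω) t) := by
    intro ω t
    have h := hasSum_lagFilter_mul (lagPoly q b) (y := fun t => Y t ω)
      (fun t => (hasSum_single_mul (fun t => Y t ω) t).summable) t
    rwa [funext fun t => (hasSum_single_mul (fun t => Y t ω) t).tsum_eq] at h
  rw [isARMA_iff]
  constructor
  · intro h
    rw [← sub_eq_zero]
    refine eq_zero_of_ae_tsum_eq_zero hindep hL2 hmean hvar ?_ ?_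
    · have h1 := (summable_abs_lagFilter hd (lagPoly p a)).of_abs
      have h2 := (summable_abs_lagFilter (geomDecay_single (E := ℝ)).summable_abs
        (lagPoly q b)).of_abs
      exact (h1.sub h2).abs
    · filter_upwards [h, hleft] with ω h1 h2
      have h3 := (h2 0).sub (hright ω 0)
      rw [h1 0, sub_self] at h3
      simpa only [← sub_mul, zero_sub, Pi.sub_apply] using h3.tsum_eq
  · intro h
    filter_upwards [hleft] with ω h2 t
    have h3 := h2 t
    rw [h] at h3
    exact h3.unique (hright ω t)

/-- If `A` has a convolution inverse `g`, the only solution of the ARMA equations bounded in `L¹`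
is obtained by convolving `A(S) X = B(S) Y` with `g`. -/
lemma IsARMA.ae_eq_maProcess {Y : ℤ → Ω → ℝ} (hY : ∀ t, AEStronglyMeasurable (Y t) P) {K : ℝ≥0}
    (hK : ∀ t, eLpNorm (Y t) 1 P ≤ K) {X : ℤ → Ω → ℝ} (hX : ∀ t, AEStronglyMeasurable (X t) P)
    {K' : ℝ≥0} (hK' : ∀ t, eLpNorm (X t) 1 P ≤ K') {p q : ℕ} {a b : ℕ → ℝ}
    (h : IsARMA P p q a b Y X) {g : ℤ → ℝ} (hg : Summable fun s => |g s|)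
    (hinv : lagFilter (lagPoly p a) g = Pi.single 0 1) (t : ℤ) :
    X t =ᵐ[P] maProcess (lagFilter (lagPoly q b) g) Y t := by
  filter_upwards [isARMA_iff.1 h, ae_summable_convolution hY hK hg,
    ae_summable_convolution hX hK' hg] with ω h1 h2 h3
  have e1 := hasSum_lagFilter_mul (lagPoly p a) (y := fun t => X t ω) h3 t
  have e2 := hasSum_mul_lagFilter (lagPoly p a) (y := fun t => X t ω) h3 t
  have e3 := hasSum_lagFilter_mul (lagPoly q b) (y := fun t => Y t ω) h2 t
  have e4 := hasSum_mul_lagFilter (lagPoly q b) (y := fun t => Y t ω) h2 t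
  rw [hinv] at e1
  simp only [h1] at e2
  calc X t ω = _ := (hasSum_single_mul (fun t => X t ω) t).unique e1
    _ = _ := e2.unique e4
    _ = _ := e3.tsum_eq.symm

end ARMA

/-- Cancelling the greatest common divisor of `A` and `B` gives a filter `c` with
`A(S) c = B(S) δ`. -/
lemma exists_lagFilter_eq_of_reducedPoly {A B : Polynomial ℝ} (hA : A ≠ 0)
    (h : NoUnitRoot (reducedPoly A B)) :
    ∃ c : ℤ → ℝ, GeomDecay c ∧ lagFilter A c = lagFilter B (Pi.single 0 1 : ℤ → ℝ) := by
  set G := EuclideanDomain.gcd A B with hG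
  have hG0 : G ≠ 0 := fun h0 => hA (EuclideanDomain.gcd_eq_zero_iff.1 h0).1
  have hAG : G * (A / G) = A :=
    EuclideanDomain.mul_div_cancel' hG0 (EuclideanDomain.gcd_dvd_left A B)
  have hBG : G * (B / G) = B :=
    EuclideanDomain.mul_div_cancel' hG0 (EuclideanDomain.gcd_dvd_right A B)
  have hA' : NoUnitRoot (A / G) := fun z hz h0 => h z hz (by
    rw [reducedPoly, map_mul, ← hG, h0, mul_zero])
  obtain ⟨c, hc, he⟩ := hA'.exists_lagFilter ((geomDecay_single (E := ℝ)).lagFilter (B / G))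
  exact ⟨c, hc, by rw [← hAG, lagFilter_mul, he, ← lagFilter_mul, hBG]⟩

lemma lagPoly_ne_zero (p : ℕ) (a : ℕ → ℝ) : lagPoly p a ≠ 0 := by
  intro h
  have := congrArg (Polynomial.eval 0) h
  rw [lagPoly, Polynomial.eval_add, Polynomial.eval_finsetSum, Finset.sum_eq_zero] at this
  · simp at this
  · intro j hj
    have : j ≠ 0 := by
      have := (Finset.mem_Icc.1 hj).1
      omega
    simp [this]

theorem corollary2 {Ω : Type*} [MeasurableSpace Ω] (P : Measure Ω) [IsProbabilityMeasure P]
    (Y : ℤ → Ω → ℝ)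
    (hmeas : ∀ t, Measurable (Y t))
    (hindep : iIndepFun Y P)
    (hmean : ∀ t, ∫ ω, Y t ω ∂P = 0)
    (hvar : ∀ t, variance (Y t) P = 1)
    (hmom : ∀ k : ℕ, ∃ M : ℝ, ∀ t,
      Integrable (fun ω => |Y t ω| ^ k) P ∧ ∫ ω, |Y t ω| ^ k ∂P ≤ M) :
    (∀ c : ℤ → ℝ, Summable (fun s => |c s|) →
      (∀ k : ℕ, Summable (fun s : ℤ => |(s : ℝ)| ^ k * |c s|)) →
        (∀ t : ℤ, ∀ᵐ ω ∂P, Summable (fun s : ℤ => c s * Y (t - s) ω)) ∧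
        (∀ t t' : ℤ, Summable (fun s : ℤ => c (t - s) * c (t' - s))) ∧
        ∃ v : ℝ≥0,
          Tendsto (averagedCovariance c) atTop (𝓝 (v : ℝ)) ∧
          SatisfiesCLT P (maProcess c Y) v) ∧
    (∀ (p q : ℕ) (a b : ℕ → ℝ), NoUnitRoot (reducedPoly (lagPoly p a) (lagPoly q b)) →
      ∃ c : ℤ → ℝ,
        (∃ C : ℝ, ∃ r : ℝ, 0 < r ∧ r < 1 ∧ ∀ s : ℤ, |c s| ≤ C * r ^ s.natAbs) ∧
        (∀ t : ℤ, ∀ᵐ ω ∂P, Summable (fun s : ℤ => c s * Y (t - s) ω)) ∧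
        IsARMA P p q a b Y (maProcess c Y) ∧
        (∀ d : ℤ → ℝ, Summable (fun s => |d s|) → IsARMA P p q a b Y (maProcess d Y) → d = c) ∧
        ∃ v : ℝ≥0,
          Tendsto (averagedCovariance c) atTop (𝓝 (v : ℝ)) ∧
          SatisfiesCLT P (maProcess c Y) v ∧
          (NoUnitRoot (lagPoly p a) →
            ∀ X : ℤ → Ω → ℝ, IsARMA P p q a b Y X → (∀ t, MemLp (X t) 2 P) →
              (∃ K : ℝ, ∀ t, ∫ ω, X t ω ^ 2 ∂P ≤ K) →
                (∀ t, X t =ᵐ[P] maProcess c Y t) ∧ SatisfiesCLT P X v)) := by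
  have hL2 : ∀ t, MemLp (Y t) 2 P := fun t => by
    obtain ⟨M, hM⟩ := hmom 2
    rw [memLp_two_iff_integrable_sq (hmeas t).aestronglyMeasurable]
    simpa only [sq_abs] using (hM t).1
  have hsq : ∀ t, ∫ ω, Y t ω ^ 2 ∂P = 1 := fun t => by
    rw [← hvar t, variance_of_integral_eq_zero (hmeas t).aemeasurable (hmean t)]
  have hYs : ∀ t, AEStronglyMeasurable (Y t) P := fun t => (hL2 t).1
  have hK : ∀ t, eLpNorm (Y t) 1 P ≤ (1 + 1 : ℝ).toNNReal := fun t =>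
    eLpNorm_one_le_of_integral_sq_le (hL2 t) (hsq t).le
  obtain ⟨M, hM⟩ := hmom 3
  have hma : ∀ c : ℤ → ℝ, Summable (fun s => |c s|) →
      (∀ k : ℕ, Summable (fun s : ℤ => |(s : ℝ)| ^ k * |c s|)) → ∃ v : ℝ≥0,
        Tendsto (averagedCovariance c) atTop (𝓝 (v : ℝ)) ∧ SatisfiesCLT P (maProcess c Y) v := by
    intro c hc hck
    obtain ⟨v, hv⟩ : ∃ v : ℝ≥0, (v : ℝ) = (∑' s, c s) ^ 2 := ⟨⟨_, sq_nonneg _⟩, rfl⟩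
    refine ⟨v, hv ▸ tendsto_averagedCovariance hc, ?_⟩
    refine tendstoInDistribution_of_tendstoInMeasure_sub _ _
      (tendstoInDistribution_const_mul_normalizedSum hindep hL2 hmean hsq hM (∑' s, c s) v hv)
      (tendstoInMeasure_normalizedSum_maProcess_sub hmeas hK hc (by simpa using hck 1)) fun n => ?_
    exact ((Finset.measurable_fun_sum _ fun t _ => measurable_maProcess hmeas c t).const_mul
      _).aemeasurable
  refine ⟨fun c hc hck => ⟨ae_all_iff.1 (ae_summable_convolution hYs hK hc),
    summable_mul_comp_sub hc, hma c hc hck⟩, fun p q a b hroot => ?_⟩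
  have hA := lagPoly_ne_zero p a
  obtain ⟨c, hc, hce⟩ := exists_lagFilter_eq_of_reducedPoly hA hroot
  have huniq : ∀ d : ℤ → ℝ, Summable (fun s => |d s|) →
      lagFilter (lagPoly p a) d = lagFilter (lagPoly q b) (Pi.single 0 1 : ℤ → ℝ) → d = c := by
    intro d hd hde
    rw [← sub_eq_zero]
    refine eq_zero_of_lagFilter_eq_zero hA ?_ (by rw [map_sub, hde, hce, sub_self])
    exact (hd.of_abs.sub hc.summable_abs.of_abs).tendsto_cofinite_zero
  obtain ⟨v, hv, hclt⟩ := hma c hc.summable_abs hc.summable_pow_mul_abs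
  refine ⟨c, hc, ae_all_iff.1 (ae_summable_convolution hYs hK hc.summable_abs),
    (isARMA_maProcess_iff hindep hL2 hmean hsq hK hc.summable_abs).2 hce,
    fun d hd h => huniq d hd ((isARMA_maProcess_iff hindep hL2 hmean hsq hK hd).1 h),
    v, hv, hclt, fun hroot' X hX hXL ⟨K, hXK⟩ => ?_⟩
  obtain ⟨g, hg, hge⟩ := hroot'.exists_lagFilter (geomDecay_single (E := ℝ))
  have hgc : lagFilter (lagPoly q b) g = c := by
    refine huniq _ (summable_abs_lagFilter hg.summable_abs _) ?_
    rw [← lagFilter_mul, mul_comm, lagFilter_mul, hge]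
  have hXc : ∀ t, X t =ᵐ[P] maProcess c Y t := fun t => hgc ▸
    hX.ae_eq_maProcess hYs hK (fun t => (hXL t).1)
      (fun t => eLpNorm_one_le_of_integral_sq_le (hXL t) (hXK t)) hg.summable_abs hge t
  refine ⟨hXc, TendstoInDistribution.congr (fun n => ?_) EventuallyEq.rfl hclt⟩
  filter_upwards [ae_all_iff.2 hXc] with ω hω
  simp only [normalizedSum, hω]
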